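/- Fix $N\ge 0$. Let $\mathfrak{LC}$ be the set of Lipschitz Carathéodory functions $f:\mathbb R\times\mathbb R^N\to\mathbb R^N$, i.e. Borel measurable functions such that for every compact $K\subset\mathbb R^N$ there are $m^K,l^K\in L^1_{loc}(\mathbb R)$ with, for almost every $t$, $|f(t,x)|\le m^K(t)$ and $|f(t,x)-f(t,y)|\le l^K(t)|x-y|$ for all $x,y\in K$; functions of this kind that are equal almost everywhere in $\mathbb R^{1+N}$ are identified. Let $f_t(s,x)=f(s+t,x)$. Let $\mathcal T$ be a metrizable topology on $\mathfrak{LC}$, with a fixed metric inducing it, let $f\in\mathfrak{LC}$ and let $\mathrm{Hull}(f)$ be the closure of $\{f_t\mid t\in\mathbb R\}$ in $(\mathfrak{LC},\mathcal T)$. For $g\in\mathfrak{LC}$ let $x(\cdot,g,x_0)$ be the Carathéodory solution of $\dot x=g(t,x)$, $x(0)=x_0$. Assume that the skew-product semiflow induced by $f$ is defined and continuous, that is: $g_t\in \mathrm{Hull}(f)$ for all $g\in\mathrm{Hull}(f)$ and $t\in\mathbb R$; for all $g\in \mathrm{Hull}(f)$ and $x_0\in\mathbb R^N$ the solution $x(\cdot,g,x_0)$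 is defined on $[0,\infty)$; and the map $\Pi(t,g,x_0)=(g_t,x(t,g,x_0))$ is continuous on $[0,\infty)\times\mathrm{Hull}(f)\times\mathbb R^N$. Write $x(t,g,D)=\{x(t,g,x_0)\mid x_0\in D\}$. Assume that there is a bounded set $B\subset\mathbb R^N$ such that for each nonempty bounded set $D\subset\mathbb R^N$ there is $T(D)\ge 0$ with $x(t,f_s,D)\subset B$ for all $t\ge T(D)$ and all $s\in\mathbb R$. Let $\mathrm{dist}(A,C)=\sup_{x\in A}\inf_{y\in C}d(x,y)$ be the Hausdorff semi-distance. A family $\{A_g\mid g\in\mathrm{Hull}(f)\}$ of nonempty compact subsets of $\mathbb R^N$ is a bounded pullback attractor if $x(t,g,A_g)=A_{g_t}$ for all $t\ge0$ and $g\in\mathrm{Hull}(f)$, $\lim_{t\to\infty}\mathrm{dist}(x(t,g_{-t},D),A_g)=0$ for every nonempty bounded $D\subset\mathbb R^N$ and every $g\in\mathrm{Hull}(f)$, and $\bigcup_{g}A_g$ is bounded. A nonempty compact set $\mathcal A\subset\mathrm{Hull}(f)\times\mathbb R^N$ is a global attractor if $\Pi(t,\mathcal A)=\mathcal A$ for all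 $t\ge0$, $\lim_{t\to\infty}\mathrm{dist}(\Pi(t,\mathcal D),\mathcal A)=0$ for every nonempty compact $\mathcal D\subset\mathrm{Hull}(f)\times\mathbb R^N$, and $\mathcal A$ contains every compact $\mathcal C\subset\mathrm{Hull}(f)\times\mathbb R^N$ with $\Pi(t,\mathcal C)=\mathcal C$ for all $t\ge0$. Then: (i) there is a unique bounded pullback attractor, and it is given by $$A_g=\bigcap_{\tau\ge0}\overline{\bigcup_{t\ge\tau}x(t,g_{-t},B)},\qquad g\in\mathrm{Hull}(f);$$ (ii) if $\mathrm{Hull}(f)$ is compact, there is a global attractor, given by $$\mathcal A=\bigcap_{\tau\ge0}\overline{\bigcup_{t\ge\tau}\Pi(t,\mathrm{Hull}(f)\times B)}=\bigcup_{g\in\mathrm{Hull}(f)}\{g\}\times A_g .$$ -/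

import Mathlib

open MeasureTheory Set Filter Topology Bornology
open scoped ENNReal

/-- The phase space `ℝ^N` with its Euclidean norm. -/
abbrev Phase (N : ℕ) : Type := EuclideanSpace ℝ (Fin N)

/-- `F : ℝ × ℝ^N → ℝ^N` is Lipschitz Carathéodory: Borel measurable, with locally integrable
bounds (`m`-bounds) and locally integrable Lipschitz constants (`l`-bounds) on compact sets. -/
structure IsLipschitzCaratheodory {N : ℕ} (F : ℝ × Phase N → Phase N) : Prop where
  measurable : Measurable F
  mbound : ∀ K : Set (Phase N), IsCompact K →
    ∃ m : ℝ → ℝ, LocallyIntegrable m volume ∧ ∀ᵐ t : ℝ, ∀ x ∈ K, ‖F (t, x)‖ ≤ m t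
  lbound : ∀ K : Set (Phase N), IsCompact K →
    ∃ l : ℝ → ℝ, LocallyIntegrable l volume ∧
      ∀ᵐ t : ℝ, ∀ x ∈ K, ∀ y ∈ K, ‖F (t, x) - F (t, y)‖ ≤ l t * ‖x - y‖

/-- Lipschitz Carathéodory functions, before the almost everywhere identification. -/
def LCFun (N : ℕ) : Type :=
  {F : ℝ × Phase N → Phase N // IsLipschitzCaratheodory F}

/-- Two Lipschitz Carathéodory functions are identified when they differ only on a negligible
subset of `ℝ^{1+N}`. -/
def LCFun.setoid (N : ℕ) : Setoid (LCFun N) where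
  r F G := F.1 =ᵐ[(volume : Measure (ℝ × Phase N))] G.1
  iseqv := ⟨fun _ => EventuallyEq.rfl, fun h => h.symm, fun h h' => h.trans h'⟩

/-- The space `LC` of Lipschitz Carathéodory functions, modulo almost everywhere equality. It
carries no topology by default: the topology is a parameter of the results. -/
def LC (N : ℕ) : Type := Quotient (LCFun.setoid N)

/-- A Lipschitz Carathéodory representative of an element of `LC`. Two such representatives `F`,
`G` satisfy `F (t, ·) = G (t, ·)` for almost every `t`, so the choice does not affect solutions. -/
noncomputable def LC.rep {N : ℕ} (g : LC N) : ℝ × Phase N → Phase N :=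
  (Quotient.out g).1

theorem measurePreserving_timeShift (N : ℕ) (t : ℝ) :
    MeasurePreserving (fun p : ℝ × Phase N => (p.1 + t, p.2)) volume volume :=
  (measurePreserving_add_right (volume : Measure ℝ) t).prod
    (MeasurePreserving.id (volume : Measure (Phase N)))

theorem locallyIntegrable_timeShift {m : ℝ → ℝ} (hm : LocallyIntegrable m volume) (t : ℝ) :
    LocallyIntegrable (fun s => m (s + t)) volume := by
  rw [locallyIntegrable_iff] at hm ⊢
  intro K hK
  have h := hm ((fun s => s + t) '' K) (hK.image (continuous_add_const t))
  exact ((measurePreserving_add_right (volume : Measure ℝ) t).integrableOn_image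
    (measurableEmbedding_addRight t)).1 h

theorem IsLipschitzCaratheodory.timeShift {N : ℕ} {F : ℝ × Phase N → Phase N}
    (hF : IsLipschitzCaratheodory F) (t : ℝ) :
    IsLipschitzCaratheodory (fun p : ℝ × Phase N => F (p.1 + t, p.2)) where
  measurable := hF.measurable.comp (measurePreserving_timeShift N t).measurable
  mbound K hK := by
    obtain ⟨m, hm, h⟩ := hF.mbound K hK
    exact ⟨fun s => m (s + t), locallyIntegrable_timeShift hm t,
      (measurePreserving_add_right (volume : Measure ℝ) t).quasiMeasurePreserving.ae h⟩
  lbound K hK := by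
    obtain ⟨l, hl, h⟩ := hF.lbound K hK
    exact ⟨fun s => l (s + t), locallyIntegrable_timeShift hl t,
      (measurePreserving_add_right (volume : Measure ℝ) t).quasiMeasurePreserving.ae h⟩

/-- Time translation `g ↦ g_t`, where `g_t (s, x) = g (s + t, x)`. -/
def LC.translate {N : ℕ} (t : ℝ) : LC N → LC N :=
  Quotient.map' (s₁ := LCFun.setoid N) (s₂ := LCFun.setoid N)
    (fun F : LCFun N => (⟨fun p => F.1 (p.1 + t, p.2), F.2.timeShift t⟩ : LCFun N))
    (fun _ _ h => (measurePreserving_timeShift N t).quasiMeasurePreserving.ae_eq_comp h)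

/-- The hull of `f`: the closure in `LC` of the set of its time translates. -/
def LC.hull {N : ℕ} [TopologicalSpace (LC N)] (f : LC N) : Set (LC N) :=
  closure (range fun t : ℝ => LC.translate t f)

/-- `x` is a (Carathéodory) solution on `[0, ∞)` of `x' = g(t, x)`, `x(0) = x₀`. -/
def LC.IsSolution {N : ℕ} (g : LC N) (x₀ : Phase N) (x : ℝ → Phase N) : Prop :=
  ContinuousOn x (Ici 0) ∧
    ∀ t : ℝ, 0 ≤ t →
      IntervalIntegrable (fun s => g.rep (s, x s)) volume 0 t ∧
        x t = x₀ + ∫ s in (0 : ℝ)..t, g.rep (s, x s)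

/-- `LC.sol t g x₀` is the value `x(t, g, x₀)`, `t ≥ 0`, of the solution of `x' = g(t, x)`,
`x(0) = x₀` (meaningful when this solution is defined on `[0, ∞)`). -/
noncomputable def LC.sol {N : ℕ} (t : ℝ) (g : LC N) (x₀ : Phase N) : Phase N :=
  Classical.epsilon (fun x : ℝ → Phase N => g.IsSolution x₀ x) t

/-- The skew-product map `Π(t, g, x₀) = (g_t, x(t, g, x₀))`. -/
noncomputable def LC.skewProduct {N : ℕ} (t : ℝ) (p : LC N × Phase N) : LC N × Phase N :=
  (LC.translate t p.1, LC.sol t p.1 p.2)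

/-- The Hausdorff semi-distance `sup_{x ∈ A} inf_{y ∈ B} d(x, y)`. -/
noncomputable def hausdorffSemidist {X : Type*} [PseudoEMetricSpace X] (A B : Set X) : ℝ≥0∞ :=
  ⨆ x ∈ A, ⨅ y ∈ B, edist x y

/-- The family `A g`, `g ∈ hull f`, is a pullback attractor for the skew-product semiflow over
`hull f` (the values of `A` outside `hull f` are irrelevant). -/
structure IsPullbackAttractor {N : ℕ} [TopologicalSpace (LC N)] (f : LC N)
    (A : LC N → Set (Phase N)) : Prop where
  nonempty : ∀ g ∈ f.hull, (A g).Nonempty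
  isCompact : ∀ g ∈ f.hull, IsCompact (A g)
  invariant : ∀ t : ℝ, 0 ≤ t → ∀ g ∈ f.hull, LC.sol t g '' A g = A (LC.translate t g)
  attracts : ∀ D : Set (Phase N), D.Nonempty → IsBounded D → ∀ g ∈ f.hull,
    Tendsto (fun t : ℝ => hausdorffSemidist (LC.sol t (LC.translate (-t) g) '' D) (A g))
      atTop (𝓝 0)

/-- A bounded pullback attractor: moreover the union of its fibres is bounded. -/
structure IsBoundedPullbackAttractor {N : ℕ} [TopologicalSpace (LC N)] (f : LC N)
    (A : LC N → Set (Phase N)) : Prop extends IsPullbackAttractor f A where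
  isBounded : IsBounded (⋃ g ∈ f.hull, A g)

/-- `𝒜` is a global attractor for the skew-product semiflow on `hull f × ℝ^N`: a nonempty compact
invariant set attracting all compact sets, and the maximal compact invariant set. -/
structure IsGlobalAttractor {N : ℕ} [MetricSpace (LC N)] (f : LC N)
    (𝒜 : Set (LC N × Phase N)) : Prop where
  subset : 𝒜 ⊆ f.hull ×ˢ univ
  nonempty : 𝒜.Nonempty
  isCompact : IsCompact 𝒜
  invariant : ∀ t : ℝ, 0 ≤ t → LC.skewProduct t '' 𝒜 = 𝒜
  attracts : ∀ 𝒟 : Set (LC N × Phase N), 𝒟 ⊆ f.hull ×ˢ univ → 𝒟.Nonempty → IsCompact 𝒟 →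
    Tendsto (fun t : ℝ => hausdorffSemidist (LC.skewProduct t '' 𝒟) 𝒜) atTop (𝓝 0)
  maximal : ∀ 𝒞 : Set (LC N × Phase N), 𝒞 ⊆ f.hull ×ˢ univ → IsCompact 𝒞 →
    (∀ t : ℝ, 0 ≤ t → LC.skewProduct t '' 𝒞 = 𝒞) → 𝒞 ⊆ 𝒜

/-- The fibre `⋂_{τ ≥ 0} cls ⋃_{t ≥ τ} x(t, g_{-t}, B)`. -/
def pullbackFibre {N : ℕ} (B : Set (Phase N)) (g : LC N) : Set (Phase N) :=
  ⋂ τ ∈ Ici (0 : ℝ), closure (⋃ t ∈ Ici τ, LC.sol t (LC.translate (-t) g) '' B)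

/-! Both parts are instances of one statement about a cocycle `φ` over a flow `θ` with a set `B`
that absorbs into its compact closure. The pullback limit set is then a decreasing intersection of
compact tails, hence nonempty and compact. It attracts because nested compact tails enter every
neighbourhood of their intersection (`tendsto_pullbackLimit`), and it is invariant because the
cocycle carries tails onto tails (`image_pullbackLimit`). Part (i) takes the hull as base. Part (ii)
takes a one-point base and phase space hull × ℝ^N, where the pullback limit is the usual omega-limit
set. The cocycle identity comes from uniqueness of Carathéodory solutions. Absorption, assumed only
along translates of `f`, extends to the hull by continuity, with `closure B` in place of `B`.
Uniqueness, maximality and half of the fibre formula all follow from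
`mem_of_tendsto_hausdorffSemidist`: a point with arbitrarily long past in an attracted set lies in
the attractor. -/

/-! ### Carathéodory solutions: representatives, uniqueness, cocycle identity -/

theorem IsLipschitzCaratheodory.ae_continuous {N : ℕ} {F : ℝ × Phase N → Phase N}
    (hF : IsLipschitzCaratheodory F) : ∀ᵐ t : ℝ, Continuous fun x => F (t, x) := by
  have h : ∀ n : ℕ, ∀ᵐ t : ℝ, ContinuousOn (fun x => F (t, x)) (Metric.closedBall 0 n) := by
    intro n
    obtain ⟨l, -, hl⟩ := hF.lbound _ (isCompact_closedBall (0 : Phase N) n)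
    filter_upwards [hl] with t ht
    refine (LipschitzOnWith.of_dist_le_mul (K := (l t).toNNReal) fun x hx y hy => ?_).continuousOn
    rw [dist_eq_norm, dist_eq_norm]
    exact (ht x hx y hy).trans
      (mul_le_mul_of_nonneg_right (Real.le_coe_toNNReal _) (norm_nonneg _))
  filter_upwards [ae_all_iff.2 h] with t ht
  refine continuous_iff_continuousAt.2 fun x => ?_
  obtain ⟨n, hn⟩ := exists_nat_gt ‖x‖
  exact (ht n).continuousAt (Metric.closedBall_mem_nhds_of_mem (by simpa using hn))

/-- Fubini gives agreement for almost every `x`, and continuity of the slices upgrades it to all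
`x`. This is needed because the graph of a solution may be a null set. -/
theorem IsLipschitzCaratheodory.ae_forall_eq {N : ℕ} {F G : ℝ × Phase N → Phase N}
    (hF : IsLipschitzCaratheodory F) (hG : IsLipschitzCaratheodory G)
    (h : F =ᵐ[(volume : Measure (ℝ × Phase N))] G) : ∀ᵐ t : ℝ, ∀ x, F (t, x) = G (t, x) := by
  filter_upwards [IsLipschitzCaratheodory.ae_continuous hF, IsLipschitzCaratheodory.ae_continuous hG,
    Measure.ae_ae_of_ae_prod h] with t h₁ h₂ h₃
  exact congrFun ((Continuous.ae_eq_iff_eq (volume : Measure (Phase N)) h₁ h₂).1 h₃)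

namespace LC

variable {N : ℕ}

theorem rep_isLipschitzCaratheodory (g : LC N) : IsLipschitzCaratheodory g.rep :=
  (Quotient.out g).2

theorem translate_zero (g : LC N) : translate 0 g = g := by
  induction g using Quotient.inductionOn with
  | h F =>
    refine Quotient.sound (s := LCFun.setoid N) (Eventually.of_forall fun p => ?_)
    simp

theorem translate_translate (s t : ℝ) (g : LC N) :
    translate s (translate t g) = translate (s + t) g := by
  induction g using Quotient.inductionOn with
  | h F =>
    refine Quotient.sound (s := LCFun.setoid N) (Eventually.of_forall fun p => ?_)
    simp [add_assoc]

theorem rep_translate (s : ℝ) (g : LC N) :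
    ∀ᵐ r : ℝ, ∀ x, (translate s g).rep (r, x) = g.rep (r + s, x) := by
  have h : translate s g = Quotient.mk (LCFun.setoid N)
      ⟨fun p => g.rep (p.1 + s, p.2), g.rep_isLipschitzCaratheodory.timeShift s⟩ := by
    conv_lhs => rw [← Quotient.out_eq g]
    rfl
  refine IsLipschitzCaratheodory.ae_forall_eq (translate s g).rep_isLipschitzCaratheodory
    (g.rep_isLipschitzCaratheodory.timeShift s) ?_
  rw [h]
  exact Quotient.mk_out (s := LCFun.setoid N) _

end LC

/-- A homogeneous Gronwall lemma with an integrable coefficient. -/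
theorem eq_zero_of_le_add_integral_mul {u l : ℝ → ℝ} {a b : ℝ} (hu : ContinuousOn u (Icc a b))
    (hu₀ : ∀ t, 0 ≤ u t) (hua : u a = 0) (hl₀ : ∀ t, 0 ≤ l t) (hl : LocallyIntegrable l volume)
    (h : ∀ c d, a ≤ c → c ≤ d → d ≤ b → u d ≤ u c + ∫ s in c..d, l s * u s) :
    ∀ t ∈ Icc a b, u t = 0 := by
  have hli : ∀ c d : ℝ, IntervalIntegrable l volume c d := fun c d =>
    (intervalIntegrable_iff.2 ((hl.integrableOn_isCompact isCompact_uIcc).mono_set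
      uIoc_subset_uIcc))
  refine IsClosed.Icc_subset_of_forall_exists_gt (s := {t | u t = 0}) ?_ hua ?_
  · rw [inter_comm]
    exact hu.preimage_isClosed_of_isClosed isClosed_Icc isClosed_singleton
  rintro c ⟨hc, hac, hcb⟩ y hy
  have hcont : Continuous fun d => ∫ s in c..d, l s :=
    intervalIntegral.continuous_primitive hli c
  -- On so short an interval, starting from `u c = 0`, the maximum of `u` is at most half of itself,
  -- so the zero set extends past `c`.
  have hev : ∀ᶠ d in 𝓝[>] c, ∫ s in c..d, l s < 1 / 2 := by
    refine (hcont.tendsto c).mono_left nhdsWithin_le_nhds |>.eventually_lt_const ?_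
    simp
  obtain ⟨d, hd, hd'⟩ := (hev.and (Ioc_mem_nhdsGT (lt_min hy hcb))).exists
  have hdb : d ≤ b := hd'.2.trans (min_le_right _ _)
  refine ⟨d, ?_, hd'.1, hd'.2.trans (min_le_left _ _)⟩
  have hsub : Icc c d ⊆ Icc a b := Icc_subset_Icc hac hdb
  obtain ⟨m, hm, hmax⟩ := isCompact_Icc.exists_isMaxOn (nonempty_Icc.2 hd'.1.le) (hu.mono hsub)
  have h₁ : ∫ s in c..m, l s * u s ≤ ∫ s in c..m, l s * u m := by
    refine intervalIntegral.integral_mono_on hm.1 ?_ ((hli c m).mul_const _) fun s hs =>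
      mul_le_mul_of_nonneg_left (hmax ⟨hs.1, hs.2.trans hm.2⟩) (hl₀ s)
    refine (hli c m).mul_continuousOn (hu.mono ?_)
    rw [uIcc_of_le hm.1]
    exact (Icc_subset_Icc_right hm.2).trans hsub
  have h₂ : ∫ s in c..m, l s ≤ ∫ s in c..d, l s :=
    intervalIntegral.integral_mono_interval le_rfl hm.1 hm.2
      (Eventually.of_forall hl₀) (hli c d)
  have h₃ := h c m hac hm.1 (hm.2.trans hdb)
  rw [intervalIntegral.integral_mul_const] at h₁
  have hc' : u c = 0 := hc
  have h₄ : u d ≤ u m := hmax ⟨hd'.1.le, le_rfl⟩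
  have := hu₀ d
  have := hu₀ m
  show u d = 0
  nlinarith

namespace LC

variable {N : ℕ} {g : LC N} {x₀ : Phase N} {x y : ℝ → Phase N}

theorem IsSolution.intervalIntegrable (hx : g.IsSolution x₀ x) {c d : ℝ} (hc : 0 ≤ c)
    (hd : 0 ≤ d) : IntervalIntegrable (fun s => g.rep (s, x s)) volume c d :=
  (hx.2 c hc).1.symm.trans (hx.2 d hd).1

theorem IsSolution.eq_add_integral (hx : g.IsSolution x₀ x) {c d : ℝ} (hc : 0 ≤ c)
    (hd : 0 ≤ d) : x d = x c + ∫ s in c..d, g.rep (s, x s) := by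
  rw [(hx.2 c hc).2, (hx.2 d hd).2, add_assoc,
    intervalIntegral.integral_add_adjacent_intervals (hx.2 c hc).1
      (hx.intervalIntegrable hc hd)]

theorem IsSolution.apply_zero (hx : g.IsSolution x₀ x) : x 0 = x₀ := by
  simpa using (hx.2 0 le_rfl).2

theorem IsSolution.unique (hx : g.IsSolution x₀ x) (hy : g.IsSolution x₀ y) {t : ℝ}
    (ht : 0 ≤ t) : x t = y t := by
  have hsub : Icc 0 t ⊆ Ici (0 : ℝ) := Icc_subset_Ici_self
  have hxc := hx.1.mono hsub
  have hyc := hy.1.mono hsub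
  obtain ⟨l, hl, hle⟩ := g.rep_isLipschitzCaratheodory.lbound _
    ((isCompact_Icc.image_of_continuousOn hxc).union (isCompact_Icc.image_of_continuousOn hyc))
  have hl' : LocallyIntegrable (fun s => |l s|) volume := fun s => (hl s).norm
  have key := eq_zero_of_le_add_integral_mul (u := fun s => ‖x s - y s‖) (l := fun s => |l s|)
    (a := 0) (b := t) (hxc.sub hyc).norm (fun _ => norm_nonneg _)
    (by simp [hx.apply_zero, hy.apply_zero]) (fun _ => abs_nonneg _) hl' ?_
  · exact sub_eq_zero.1 (norm_eq_zero.1 (key t ⟨ht, le_rfl⟩))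
  intro c d hc hcd hdt
  have hd := hc.trans hcd
  have hixy := (hx.intervalIntegrable hc hd).sub (hy.intervalIntegrable hc hd)
  have hdiff : x d - y d = (x c - y c) + ∫ s in c..d, (g.rep (s, x s) - g.rep (s, y s)) := by
    rw [intervalIntegral.integral_sub (hx.intervalIntegrable hc hd)
      (hy.intervalIntegrable hc hd), hx.eq_add_integral hc hd, hy.eq_add_integral hc hd]
    abel
  have hint : IntervalIntegrable (fun s => |l s| * ‖x s - y s‖) volume c d := by
    refine IntervalIntegrable.mul_continuousOn ?_ ((hxc.sub hyc).norm.mono ?_)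
    · exact intervalIntegrable_iff.2 ((hl'.integrableOn_isCompact isCompact_uIcc).mono_set
        uIoc_subset_uIcc)
    · rw [uIcc_of_le hcd]
      exact Icc_subset_Icc hc hdt
  simp only [hdiff]
  refine (norm_add_le _ _).trans (add_le_add_right ?_ _)
  refine intervalIntegral.norm_integral_le_of_norm_le hcd ?_ hint
  filter_upwards [hle] with s hs hscd
  have hs' : s ∈ Icc 0 t := ⟨hc.trans hscd.1.le, hscd.2.trans hdt⟩
  exact (hs _ (.inl (mem_image_of_mem _ hs')) _ (.inr (mem_image_of_mem _ hs'))).trans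
    (mul_le_mul_of_nonneg_right (le_abs_self _) (norm_nonneg _))

theorem IsSolution.translate (hx : g.IsSolution x₀ x) {s : ℝ} (hs : 0 ≤ s) :
    (LC.translate s g).IsSolution (x s) fun r => x (r + s) := by
  have hae : ∀ᵐ r : ℝ, (LC.translate s g).rep (r, x (r + s)) = g.rep (r + s, x (r + s)) := by
    filter_upwards [g.rep_translate s] with r hr using hr _
  refine ⟨hx.1.comp (by fun_prop) fun r hr => add_nonneg hr hs, fun t ht => ⟨?_, ?_⟩⟩
  · have h := (hx.intervalIntegrable hs (add_nonneg ht hs)).comp_add_right s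
    simp only [sub_self, add_sub_cancel_right] at h
    exact h.congr_ae (ae_restrict_of_ae (hae.mono fun r hr => hr.symm))
  · rw [intervalIntegral.integral_congr_ae (hae.mono fun r hr _ => hr),
      intervalIntegral.integral_comp_add_right (fun r => g.rep (r, x r)), zero_add]
    exact hx.eq_add_integral hs (add_nonneg ht hs)

theorem isSolution_sol (h : ∃ x, g.IsSolution x₀ x) : g.IsSolution x₀ fun t => sol t g x₀ :=
  Classical.epsilon_spec h

theorem sol_add (hg : ∃ x, g.IsSolution x₀ x) {s t : ℝ} (hs : 0 ≤ s) (ht : 0 ≤ t) :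
    sol (s + t) g x₀ = sol s (LC.translate t g) (sol t g x₀) := by
  have h := (isSolution_sol hg).translate ht
  exact h.unique (isSolution_sol ⟨_, h⟩) hs

end LC

/-! ### Pullback limit sets of abstract cocycles -/

section Cocycle

variable {P Y : Type*} [MetricSpace Y]

/-- A cocycle `φ` over the flow `θ`, acting continuously on the set `Z`. -/
structure IsCocycleOn (θ : ℝ → P → P) (φ : ℝ → P → Y → Y) (Z : Set Y) : Prop where
  flow_zero : ∀ p, θ 0 p = p
  flow_add : ∀ s t p, θ s (θ t p) = θ (s + t) p
  mapsTo : ∀ t, 0 ≤ t → ∀ p, MapsTo (φ t p) Z Z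
  continuousOn : ∀ t, 0 ≤ t → ∀ p, ContinuousOn (φ t p) Z
  map_add : ∀ s t, 0 ≤ s → 0 ≤ t → ∀ p, ∀ z ∈ Z, φ (s + t) p z = φ s (θ t p) (φ t p z)

/-- The closure of the pullback tail of `B` from time `τ` on. -/
def pullbackTail (θ : ℝ → P → P) (φ : ℝ → P → Y → Y) (B : Set Y) (τ : ℝ) (p : P) : Set Y :=
  closure (⋃ t ∈ Ici τ, φ t (θ (-t) p) '' B)

/-- The pullback limit set of `B`. -/
def pullbackLimit (θ : ℝ → P → P) (φ : ℝ → P → Y → Y) (B : Set Y) (p : P) : Set Y :=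
  ⋂ τ ∈ Ici (0 : ℝ), pullbackTail θ φ B τ p

theorem tendsto_hausdorffSemidist_zero {S : ℝ → Set Y} {A : Set Y}
    (h : ∀ U, IsOpen U → A ⊆ U → ∀ᶠ t in atTop, S t ⊆ U) :
    Tendsto (fun t => hausdorffSemidist (S t) A) atTop (𝓝 0) := by
  refine ENNReal.tendsto_nhds_zero.2 fun ε hε => ?_
  obtain ⟨δ, hδ, hδε⟩ : ∃ δ : ℝ, 0 < δ ∧ ENNReal.ofReal δ ≤ ε := by
    rcases eq_or_ne ε ⊤ with rfl | hε'
    · exact ⟨1, one_pos, le_top⟩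
    · exact ⟨ε.toReal, ENNReal.toReal_pos hε.ne' hε', ENNReal.ofReal_toReal_le⟩
  filter_upwards [h _ Metric.isOpen_thickening (Metric.self_subset_thickening hδ A)] with t ht
  exact iSup₂_le fun x hx => (Metric.mem_thickening_iff_infEDist_lt.1 (ht hx)).le.trans hδε

theorem mem_of_tendsto_hausdorffSemidist {S : ℝ → Set Y} {A : Set Y} (hA : IsClosed A)
    (h : Tendsto (fun t => hausdorffSemidist (S t) A) atTop (𝓝 0)) {y : Y}
    (hy : ∀ t, 0 ≤ t → y ∈ S t) : y ∈ A := by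
  rw [Metric.mem_iff_infEDist_zero_of_closed hA]
  refine le_antisymm (ge_of_tendsto h ?_) zero_le
  filter_upwards [eventually_ge_atTop 0] with t ht
  exact le_iSup₂_of_le (f := fun x _ => ⨅ z ∈ A, edist x z) y (hy t ht) le_rfl

variable {θ : ℝ → P → P} {φ : ℝ → P → Y → Y} {Z B D : Set Y}

theorem pullbackTail_anti (p : P) : Antitone fun τ => pullbackTail θ φ B τ p := fun _ _ h =>
  closure_mono (biUnion_subset_biUnion_left (Ici_subset_Ici.2 h))

theorem isClosed_pullbackLimit (p : P) : IsClosed (pullbackLimit θ φ B p) :=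
  isClosed_biInter fun _ _ => isClosed_closure

/-- Tails decrease in `τ`, so the intersection may start at any time, in particular once the tails
are compact. -/
theorem mem_pullbackLimit_iff {a : ℝ} {p : P} {y : Y} :
    y ∈ pullbackLimit θ φ B p ↔ ∀ τ, a ≤ τ → y ∈ pullbackTail θ φ B τ p := by
  simp only [pullbackLimit, mem_iInter₂, mem_Ici]
  refine ⟨fun h τ _ => ?_, fun h τ _ =>
    pullbackTail_anti p (le_max_left τ a) (h _ (le_max_right _ _))⟩
  exact pullbackTail_anti p (le_max_left τ 0) (h _ (le_max_right _ _))

theorem pullbackLimit_eq_iInter_nat (a : ℝ) (p : P) :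
    pullbackLimit θ φ B p = ⋂ n : ℕ, pullbackTail θ φ B (a + n) p := by
  ext y
  rw [mem_pullbackLimit_iff (a := a), mem_iInter]
  refine ⟨fun h n => h _ (by simp), fun h τ _ => ?_⟩
  obtain ⟨n, hn⟩ := exists_nat_ge (τ - a)
  exact pullbackTail_anti p (by linarith) (h n)

theorem pullbackTail_subset_closure {a : ℝ} (habs : ∀ t, a ≤ t → ∀ p, φ t p '' B ⊆ closure B)
    {τ : ℝ} (hτ : a ≤ τ) (p : P) : pullbackTail θ φ B τ p ⊆ closure B :=
  closure_minimal (iUnion₂_subset fun t ht => habs t (hτ.trans ht) _) isClosed_closure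

theorem pullbackTail_nonempty (hB : B.Nonempty) (τ : ℝ) (p : P) :
    (pullbackTail θ φ B τ p).Nonempty := by
  obtain ⟨b, hb⟩ := hB
  exact ⟨_, subset_closure (mem_biUnion (mem_Ici.2 le_rfl) (mem_image_of_mem _ hb))⟩

theorem isCompact_pullbackTail (hBc : IsCompact (closure B)) {a : ℝ}
    (habs : ∀ t, a ≤ t → ∀ p, φ t p '' B ⊆ closure B) {τ : ℝ} (hτ : a ≤ τ) (p : P) :
    IsCompact (pullbackTail θ φ B τ p) :=
  hBc.of_isClosed_subset isClosed_closure (pullbackTail_subset_closure habs hτ p)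

theorem pullbackLimit_subset_closure {a : ℝ}
    (habs : ∀ t, a ≤ t → ∀ p, φ t p '' B ⊆ closure B) (p : P) :
    pullbackLimit θ φ B p ⊆ closure B := fun _ hy =>
  pullbackTail_subset_closure habs le_rfl p (mem_pullbackLimit_iff.1 hy a le_rfl)

theorem isCompact_pullbackLimit (hBc : IsCompact (closure B)) {a : ℝ}
    (habs : ∀ t, a ≤ t → ∀ p, φ t p '' B ⊆ closure B) (p : P) :
    IsCompact (pullbackLimit θ φ B p) :=
  hBc.of_isClosed_subset (isClosed_pullbackLimit p) (pullbackLimit_subset_closure habs p)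

theorem pullbackLimit_nonempty (hB : B.Nonempty) (hBc : IsCompact (closure B)) {a : ℝ}
    (habs : ∀ t, a ≤ t → ∀ p, φ t p '' B ⊆ closure B) (p : P) :
    (pullbackLimit θ φ B p).Nonempty := by
  rw [pullbackLimit_eq_iInter_nat a]
  refine IsCompact.nonempty_iInter_of_sequence_nonempty_isCompact_isClosed _
    (fun n => pullbackTail_anti p (by push_cast; linarith)) (fun n => pullbackTail_nonempty hB _ p)
    ?_ fun n => isClosed_closure
  exact isCompact_pullbackTail hBc habs (by simp) p

namespace IsCocycleOn

theorem flow_neg_flow (h : IsCocycleOn θ φ Z) (t : ℝ) (p : P) : θ t (θ (-t) p) = p := by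
  rw [h.flow_add, add_neg_cancel, h.flow_zero]

/-- Split `t` as `τ + (t - τ)`: the first `t - τ` units bring `D` into `closure B`, and the last `τ`
units carry `closure B` into the closure of the image of `B`, by continuity. -/
theorem image_subset_pullbackTail (h : IsCocycleOn θ φ Z) (hBZ : closure B ⊆ Z) (hDZ : D ⊆ Z)
    {a : ℝ} (habs : ∀ t, a ≤ t → ∀ p, φ t p '' D ⊆ closure B) {τ t : ℝ} (hτ : 0 ≤ τ)
    (ht : max a 0 + τ ≤ t) (p : P) : φ t (θ (-t) p) '' D ⊆ pullbackTail θ φ B τ p := by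
  rintro _ ⟨z, hz, rfl⟩
  have ha := le_max_left a 0
  have ha' := le_max_right a 0
  have h₁ := h.map_add τ (t - τ) hτ (by linarith) (θ (-t) p) z (hDZ hz)
  rw [h.flow_add, add_sub_cancel, show t - τ + -t = -τ by ring] at h₁
  rw [h₁]
  have hmem := habs (t - τ) (by linarith) (θ (-t) p) (mem_image_of_mem _ hz)
  refine closure_mono (subset_biUnion_of_mem (u := fun t => φ t (θ (-t) p) '' B) self_mem_Ici) ?_
  exact ((h.continuousOn τ hτ (θ (-τ) p)).mono hBZ).image_closure (mem_image_of_mem _ hmem)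

theorem tendsto_pullbackLimit (h : IsCocycleOn θ φ Z) (hBZ : closure B ⊆ Z)
    (hBc : IsCompact (closure B)) {b : ℝ} (hb : ∀ t, b ≤ t → ∀ p, φ t p '' B ⊆ closure B)
    (hDZ : D ⊆ Z) {a : ℝ} (habs : ∀ t, a ≤ t → ∀ p, φ t p '' D ⊆ closure B) (p : P) :
    Tendsto (fun t => hausdorffSemidist (φ t (θ (-t) p) '' D) (pullbackLimit θ φ B p))
      atTop (𝓝 0) := by
  refine tendsto_hausdorffSemidist_zero fun U hU hAU => ?_
  rw [pullbackLimit_eq_iInter_nat (max b 0)] at hAU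
  obtain ⟨n, hn⟩ := exists_subset_nhds_of_isCompact
    (V := fun n : ℕ => pullbackTail θ φ B (max b 0 + n) p)
    (directed_of_isDirected_le fun m n hmn => pullbackTail_anti p (by gcongr))
    (fun n => isCompact_pullbackTail hBc hb ((le_max_left b 0).trans (by simp)) p)
    (fun x hx => hU.mem_nhds (hAU hx))
  filter_upwards [eventually_ge_atTop (max a 0 + (max b 0 + n))] with t ht
  exact (h.image_subset_pullbackTail hBZ hDZ habs (by positivity) ht p).trans hn

theorem image_pullbackLimit (h : IsCocycleOn θ φ Z) (hBZ : closure B ⊆ Z)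
    (hBc : IsCompact (closure B)) {b : ℝ} (hb : ∀ t, b ≤ t → ∀ p, φ t p '' B ⊆ closure B)
    {t : ℝ} (ht : 0 ≤ t) (p : P) :
    φ t p '' pullbackLimit θ φ B p = pullbackLimit θ φ B (θ t p) := by
  set a := max b 0 with ha
  have ha₀ : 0 ≤ a := le_max_right _ _
  have hba : b ≤ a := le_max_left _ _
  have htail : ∀ τ, a ≤ τ → pullbackTail θ φ B τ p ⊆ Z := fun τ hτ =>
    (pullbackTail_subset_closure hb (hba.trans hτ) p).trans hBZ
  have hunion : ∀ τ, a ≤ τ → φ t p '' (⋃ s ∈ Ici τ, φ s (θ (-s) p) '' B) =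
      ⋃ s ∈ Ici (t + τ), φ s (θ (-s) (θ t p)) '' B := by
    intro τ hτ
    have hstep : ∀ s, 0 ≤ s → ∀ z ∈ B,
        φ t p (φ s (θ (-s) p) z) = φ (t + s) (θ (-(t + s)) (θ t p)) z := by
      intro s hs z hz
      have h₁ := h.map_add t s ht hs (θ (-s) p) z (hBZ (subset_closure hz))
      rw [h.flow_neg_flow] at h₁
      rw [h.flow_add, show -(t + s) + t = -s by ring, h₁]
    ext y
    simp only [mem_image, mem_iUnion, mem_Ici, exists_prop]
    constructor
    · rintro ⟨_, ⟨s, hs, z, hz, rfl⟩, rfl⟩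
      exact ⟨t + s, by linarith, z, hz, (hstep s (by linarith) z hz).symm⟩
    · rintro ⟨s, hs, z, hz, rfl⟩
      refine ⟨_, ⟨s - t, by linarith, z, hz, rfl⟩, ?_⟩
      rw [hstep (s - t) (by linarith) z hz, add_sub_cancel]
  -- The closure passes through the map because the tail is compact, so its image is closed.
  have himage : ∀ τ, a ≤ τ →
      φ t p '' pullbackTail θ φ B τ p = pullbackTail θ φ B (t + τ) (θ t p) := by
    intro τ hτ
    have hc := (h.continuousOn t ht p).mono (htail τ hτ)
    have hK := isCompact_pullbackTail (θ := θ) hBc hb (hba.trans hτ) p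
    refine (hc.image_closure.trans (hunion τ hτ ▸ Subset.rfl)).antisymm ?_
    refine closure_minimal ?_ (hK.image_of_continuousOn hc).isClosed
    rw [← hunion τ hτ]
    exact image_mono subset_closure
  apply Subset.antisymm
  · rintro _ ⟨y, hy, rfl⟩
    refine (mem_pullbackLimit_iff (a := t + a)).2 fun τ hτ => ?_
    have h₁ := himage (τ - t) (by linarith)
    rw [add_sub_cancel] at h₁
    rw [← h₁]
    exact mem_image_of_mem _ (mem_pullbackLimit_iff.1 hy (τ - t) (by linarith : a ≤ τ - t))
  · intro y hy
    have hc := fun n : ℕ => (h.continuousOn t ht p).mono (htail (a + n) (by simp))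
    -- The preimages of `y` in the tails are nested, nonempty and compact; a common point is a
    -- preimage in the limit set.
    have hcl : ∀ n : ℕ, IsClosed (pullbackTail θ φ B (a + n) p ∩ φ t p ⁻¹' {y}) := fun n =>
      (hc n).preimage_isClosed_of_isClosed isClosed_closure isClosed_singleton
    obtain ⟨z, hz⟩ := IsCompact.nonempty_iInter_of_sequence_nonempty_isCompact_isClosed
      (fun n : ℕ => pullbackTail θ φ B (a + n) p ∩ φ t p ⁻¹' {y})
      (fun n => inter_subset_inter_left _ (pullbackTail_anti p (by push_cast; linarith)))
      (fun n => by
        have hy' := mem_pullbackLimit_iff.1 hy (t + (a + n)) le_rfl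
        rw [← himage (a + n) (by simp)] at hy'
        obtain ⟨z, hz, hzy⟩ := hy'
        exact ⟨z, hz, hzy⟩)
      ((isCompact_pullbackTail hBc hb (hba.trans (by simp)) p).of_isClosed_subset (hcl 0)
        inter_subset_left) hcl
    rw [mem_iInter] at hz
    refine ⟨z, ?_, (hz 0).2⟩
    rw [pullbackLimit_eq_iInter_nat a]
    exact mem_iInter.2 fun n => (hz n).1

end IsCocycleOn

end Cocycle

/-! ### The hull and its two cocycles -/

section Hull

variable {N : ℕ} [MetricSpace (LC N)] {f : LC N} {B : Set (Phase N)}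

/-- The translation flow on the hull of `f`. -/
def hullFlow (hflow : ∀ t : ℝ, ∀ g ∈ f.hull, LC.translate t g ∈ f.hull) (t : ℝ) (g : f.hull) :
    f.hull :=
  ⟨LC.translate t g, hflow t g g.2⟩

theorem LC.self_mem_hull (f : LC N) : f ∈ f.hull :=
  subset_closure ⟨0, f.translate_zero⟩

theorem LC.isClosed_hull (f : LC N) : IsClosed f.hull := isClosed_closure

theorem continuousOn_skewProduct
    (hcont : ContinuousOn (fun p : ℝ × (LC N × Phase N) => LC.skewProduct p.1 p.2)
      (Ici (0 : ℝ) ×ˢ (f.hull ×ˢ (univ : Set (Phase N))))) {t : ℝ} (ht : 0 ≤ t) :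
    ContinuousOn (LC.skewProduct t) (f.hull ×ˢ (univ : Set (Phase N))) :=
  hcont.comp (f := fun q : LC N × Phase N => (t, q)) (by fun_prop) fun _ hq => ⟨ht, hq⟩

theorem isCocycleOn_sol (hflow : ∀ t : ℝ, ∀ g ∈ f.hull, LC.translate t g ∈ f.hull)
    (hglobal : ∀ g ∈ f.hull, ∀ x₀ : Phase N, ∃ x : ℝ → Phase N, g.IsSolution x₀ x)
    (hcont : ContinuousOn (fun p : ℝ × (LC N × Phase N) => LC.skewProduct p.1 p.2)
      (Ici (0 : ℝ) ×ˢ (f.hull ×ˢ (univ : Set (Phase N))))) :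
    IsCocycleOn (hullFlow hflow) (fun t g => LC.sol t g.1) (univ : Set (Phase N)) where
  flow_zero g := Subtype.ext (LC.translate_zero _)
  flow_add s t g := Subtype.ext (LC.translate_translate s t _)
  mapsTo _ _ _ := mapsTo_univ _ _
  continuousOn t ht g := continuous_snd.comp_continuousOn
    ((continuousOn_skewProduct hcont ht).comp (f := fun x : Phase N => (g.1, x)) (by fun_prop)
      fun _ _ => ⟨g.2, mem_univ _⟩)
  map_add s t hs ht g z _ := LC.sol_add (hglobal g g.2 z) hs ht

theorem isCocycleOn_skewProduct (hflow : ∀ t : ℝ, ∀ g ∈ f.hull, LC.translate t g ∈ f.hull)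
    (hglobal : ∀ g ∈ f.hull, ∀ x₀ : Phase N, ∃ x : ℝ → Phase N, g.IsSolution x₀ x)
    (hcont : ContinuousOn (fun p : ℝ × (LC N × Phase N) => LC.skewProduct p.1 p.2)
      (Ici (0 : ℝ) ×ˢ (f.hull ×ˢ (univ : Set (Phase N))))) :
    IsCocycleOn (fun _ p => p) (fun t (_ : Unit) => LC.skewProduct t)
      (f.hull ×ˢ (univ : Set (Phase N))) where
  flow_zero _ := rfl
  flow_add _ _ _ := rfl
  mapsTo t _ _ _ hp := ⟨hflow t _ hp.1, mem_univ _⟩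
  continuousOn _ ht _ := continuousOn_skewProduct hcont ht
  map_add s t hs ht _ p hp := Prod.ext (LC.translate_translate s t p.1).symm
    (LC.sol_add (hglobal p.1 hp.1 p.2) hs ht)

/-- An absorption estimate along the translates of `f` passes to the hull. -/
theorem sol_image_subset_closure
    (hcont : ContinuousOn (fun p : ℝ × (LC N × Phase N) => LC.skewProduct p.1 p.2)
      (Ici (0 : ℝ) ×ˢ (f.hull ×ˢ (univ : Set (Phase N))))) {t : ℝ} (ht : 0 ≤ t)
    {D : Set (Phase N)} (h : ∀ s : ℝ, LC.sol t (LC.translate s f) '' D ⊆ B) {g : LC N}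
    (hg : g ∈ f.hull) : LC.sol t g '' D ⊆ closure B := by
  rintro _ ⟨x, hx, rfl⟩
  have hc : ContinuousOn (fun g => LC.sol t g x) (closure (range fun s => LC.translate s f)) :=
    continuous_snd.comp_continuousOn ((continuousOn_skewProduct hcont ht).comp
      (f := fun g : LC N => (g, x)) (by fun_prop) fun _ hg => ⟨hg, mem_univ _⟩)
  refine closure_mono ?_ (hc.image_closure (mem_image_of_mem _ hg))
  rintro _ ⟨_, ⟨s, rfl⟩, rfl⟩
  exact h s (mem_image_of_mem _ hx)

/-- By invariance, a point of `A g` is reached from the bounded union of the fibres, started at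
`g_{-t}`, for every `t ≥ 0`; `A' g` attracts that union. -/
theorem IsBoundedPullbackAttractor.subset {A A' : LC N → Set (Phase N)}
    (hA : IsBoundedPullbackAttractor f A) (hA' : IsPullbackAttractor f A')
    (hflow : ∀ t : ℝ, ∀ g ∈ f.hull, LC.translate t g ∈ f.hull) {g : LC N} (hg : g ∈ f.hull) :
    A g ⊆ A' g := by
  intro y hy
  have hne : (⋃ g ∈ f.hull, A g).Nonempty := ⟨y, mem_biUnion hg hy⟩
  refine mem_of_tendsto_hausdorffSemidist (hA'.isCompact g hg).isClosed
    (hA'.attracts _ hne hA.isBounded g hg) fun t ht => ?_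
  have h := hA.invariant t ht _ (hflow (-t) g hg)
  rw [LC.translate_translate, add_neg_cancel, LC.translate_zero] at h
  rw [← h] at hy
  exact image_mono (subset_biUnion_of_mem (u := A) (hflow (-t) g hg)) hy

end Hull

/-! ### The main theorem -/

theorem mainTheorem10 (N : ℕ) [MetricSpace (LC N)] (f : LC N)
    (hflow : ∀ t : ℝ, ∀ g ∈ f.hull, LC.translate t g ∈ f.hull)
    (hglobal : ∀ g ∈ f.hull, ∀ x₀ : Phase N, ∃ x : ℝ → Phase N, g.IsSolution x₀ x)
    (hcont : ContinuousOn (fun p : ℝ × (LC N × Phase N) => LC.skewProduct p.1 p.2)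
      (Ici (0 : ℝ) ×ˢ (f.hull ×ˢ (univ : Set (Phase N)))))
    (B : Set (Phase N)) (hB : IsBounded B)
    (habsorb : ∀ D : Set (Phase N), D.Nonempty → IsBounded D →
      ∃ T : ℝ, 0 ≤ T ∧ ∀ s t : ℝ, T ≤ t → LC.sol t (LC.translate s f) '' D ⊆ B) :
    (IsBoundedPullbackAttractor f (pullbackFibre B) ∧
      ∀ A : LC N → Set (Phase N), IsBoundedPullbackAttractor f A →
        ∀ g ∈ f.hull, A g = pullbackFibre B g) ∧
    (IsCompact f.hull →
      IsGlobalAttractor f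
        (⋂ τ ∈ Ici (0 : ℝ), closure (⋃ t ∈ Ici τ, LC.skewProduct t '' (f.hull ×ˢ B))) ∧
      (⋂ τ ∈ Ici (0 : ℝ), closure (⋃ t ∈ Ici τ, LC.skewProduct t '' (f.hull ×ˢ B))) =
        ⋃ g ∈ f.hull, {g} ×ˢ pullbackFibre B g) := by
  have hBne : B.Nonempty := by
    obtain ⟨T, -, hT⟩ := habsorb {0} (singleton_nonempty _) isBounded_singleton
    exact ((singleton_nonempty (0 : Phase N)).image _).mono (hT 0 T le_rfl)
  have hBc : IsCompact (closure B) := hB.isCompact_closure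
  have habs : ∀ D : Set (Phase N), D.Nonempty → IsBounded D →
      ∃ T : ℝ, 0 ≤ T ∧ ∀ t, T ≤ t → ∀ g ∈ f.hull, LC.sol t g '' D ⊆ closure B := by
    intro D hD hDb
    obtain ⟨T, hT₀, hT⟩ := habsorb D hD hDb
    exact ⟨T, hT₀, fun t ht g hg =>
      sol_image_subset_closure hcont (hT₀.trans ht) (fun s => hT s t ht) hg⟩
  obtain ⟨b, hb₀, hb⟩ := habs B hBne hB
  have hφ := isCocycleOn_sol hflow hglobal hcont
  have hbφ : ∀ t, b ≤ t → ∀ g : f.hull, LC.sol t g.1 '' B ⊆ closure B :=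
    fun t ht g => hb t ht g g.2
  have hA : IsBoundedPullbackAttractor f (pullbackFibre B) :=
    { nonempty := fun g hg =>
        pullbackLimit_nonempty (θ := hullFlow hflow) hBne hBc hbφ ⟨g, hg⟩
      isCompact := fun g hg => isCompact_pullbackLimit (θ := hullFlow hflow) hBc hbφ ⟨g, hg⟩
      invariant := fun t ht g hg =>
        hφ.image_pullbackLimit (subset_univ _) hBc hbφ ht ⟨g, hg⟩
      attracts := fun D hD hDb g hg => by
        obtain ⟨a, -, ha⟩ := habs D hD hDb
        exact hφ.tendsto_pullbackLimit (subset_univ _) hBc hbφ (subset_univ D)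
          (fun t ht g => ha t ht g g.2) ⟨g, hg⟩
      isBounded := hBc.isBounded.subset (iUnion₂_subset fun g hg =>
        pullbackLimit_subset_closure (θ := hullFlow hflow) hbφ ⟨g, hg⟩) }
  refine ⟨⟨hA, fun A hA' g hg => (hA'.subset hA.toIsPullbackAttractor hflow hg).antisymm
    (hA.subset hA'.toIsPullbackAttractor hflow hg)⟩, fun hH => ?_⟩
  have hψ := isCocycleOn_skewProduct hflow hglobal hcont
  have hcl : closure (f.hull ×ˢ B) = f.hull ×ˢ closure B := by
    rw [closure_prod_eq, f.isClosed_hull.closure_eq]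
  have hHBc : IsCompact (closure (f.hull ×ˢ B)) := hcl ▸ hH.prod hBc
  have hHBZ : closure (f.hull ×ˢ B) ⊆ f.hull ×ˢ univ :=
    hcl ▸ prod_mono Subset.rfl (subset_univ _)
  have habs' : ∀ 𝒟 : Set (LC N × Phase N), 𝒟 ⊆ f.hull ×ˢ univ → 𝒟.Nonempty →
      IsBounded (Prod.snd '' 𝒟) →
      ∃ T : ℝ, ∀ t, T ≤ t → ∀ _ : Unit, LC.skewProduct t '' 𝒟 ⊆ closure (f.hull ×ˢ B) := by
    intro 𝒟 h𝒟 hne hbd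
    obtain ⟨T, -, hT⟩ := habs _ (hne.image _) hbd
    refine ⟨T, fun t ht _ => ?_⟩
    rw [hcl]
    rintro _ ⟨p, hp, rfl⟩
    exact ⟨hflow t _ (h𝒟 hp).1,
      hT t ht p.1 (h𝒟 hp).1 (mem_image_of_mem _ (mem_image_of_mem _ hp))⟩
  obtain ⟨c, hc⟩ := habs' (f.hull ×ˢ B) (prod_mono Subset.rfl (subset_univ _))
    (Set.Nonempty.prod ⟨f, f.self_mem_hull⟩ hBne) (hB.subset (snd_image_prod_subset _ _))
  set 𝒜 := ⋂ τ ∈ Ici (0 : ℝ), closure (⋃ t ∈ Ici τ, LC.skewProduct t '' (f.hull ×ˢ B))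
  have h𝒜Z : 𝒜 ⊆ f.hull ×ˢ univ := (pullbackLimit_subset_closure
    (θ := fun _ p => p) hc ()).trans hHBZ
  have h𝒜c : IsCompact 𝒜 := isCompact_pullbackLimit (θ := fun _ p => p) hHBc hc ()
  have h𝒜inv : ∀ t : ℝ, 0 ≤ t → LC.skewProduct t '' 𝒜 = 𝒜 := fun t ht =>
    hψ.image_pullbackLimit hHBZ hHBc hc ht ()
  have h𝒜att : ∀ 𝒟 : Set (LC N × Phase N), 𝒟 ⊆ f.hull ×ˢ univ → 𝒟.Nonempty → IsCompact 𝒟 →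
      Tendsto (fun t : ℝ => hausdorffSemidist (LC.skewProduct t '' 𝒟) 𝒜) atTop (𝓝 0) := by
    intro 𝒟 h𝒟 hne hcpt
    obtain ⟨a, ha⟩ := habs' 𝒟 h𝒟 hne (hcpt.image continuous_snd).isBounded
    exact hψ.tendsto_pullbackLimit hHBZ hHBc hc h𝒟 ha ()
  refine ⟨⟨h𝒜Z, pullbackLimit_nonempty (θ := fun _ p => p)
    (Set.Nonempty.prod ⟨f, f.self_mem_hull⟩ hBne) hHBc hc (), h𝒜c, h𝒜inv, h𝒜att, ?_⟩, ?_⟩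
  · intro 𝒞 h𝒞 h𝒞c h𝒞inv p hp
    exact mem_of_tendsto_hausdorffSemidist h𝒜c.isClosed (h𝒜att 𝒞 h𝒞 ⟨p, hp⟩ h𝒞c)
      fun t ht => (h𝒞inv t ht).symm ▸ hp
  apply Subset.antisymm
  · rintro ⟨g, y⟩ hp
    have hg := (h𝒜Z hp).1
    refine mem_biUnion hg ⟨rfl, ?_⟩
    refine mem_of_tendsto_hausdorffSemidist (hA.isCompact g hg).isClosed
      -- The projection of `𝒜` is bounded, and by invariance `(g, y)` has, for each `t ≥ 0`, a
      -- predecessor in `𝒜` over `g_{-t}`.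
      (hA.attracts (Prod.snd '' 𝒜) ⟨_, mem_image_of_mem _ hp⟩
        (h𝒜c.image continuous_snd).isBounded g hg) fun t ht => ?_
    rw [← h𝒜inv t ht] at hp
    obtain ⟨⟨g', y'⟩, hp', heq⟩ := hp
    obtain ⟨rfl, rfl⟩ := Prod.ext_iff.1 heq
    refine ⟨y', ⟨_, hp', rfl⟩, ?_⟩
    simp only [LC.skewProduct]
    rw [LC.translate_translate, neg_add_cancel, LC.translate_zero]
  · rintro ⟨g, y⟩ hp
    obtain ⟨g', hg, rfl, hy⟩ := mem_iUnion₂.1 hp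
    refine mem_iInter₂.2 fun τ hτ => ?_
    -- Since `(g, x(t, g_{-t}, z)) = Π(t, g_{-t}, z)`, the section at `g` maps each fibre tail into
    -- the corresponding tail of `Π`.
    refine map_mem_closure (f := fun x : Phase N => (g, x)) (by fun_prop)
      (mem_iInter₂.1 hy τ hτ) ?_
    intro x hx
    obtain ⟨t, ht, z, hz, rfl⟩ := mem_iUnion₂.1 hx
    refine mem_biUnion ht ⟨(LC.translate (-t) g, z), ⟨hflow _ _ hg, hz⟩, ?_⟩
    simp only [LC.skewProduct]
    rw [LC.translate_translate, add_neg_cancel, LC.translate_zero]
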